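/- Let $q$ be a prime power. Let $E(q,n)$ be the set of all subspaces of $\mathrm{GF}(q)^n$ and $E_r(q,n)$ the set of those of dimension $r$. For $U,V\in E(q,n)$ let $d_S(U,V)=\dim(U+V)-\dim(U\cap V)$ be the subspace distance and $d_I(U,V)=\max\{\dim U,\dim V\}-\dim(U\cap V)$ the injection distance (so $d_I=\tfrac12 d_S$ on $E_r(q,n)$). Let $A_S(q,n,d)$ be the maximum cardinality of a nonempty subset of $E(q,n)$ any two distinct members of which have subspace distance at least $d$, and, for $0\le r\le n$, let $A_C(q,n,r,d)$ be the maximum cardinality of a nonempty subset of $E_r(q,n)$ (a constant-dimension code, CDC) any two distinct members of which have injection distance at least $d$. For $0\le d'\le 1$ and $0\le r'\le 1$ put $$a_S(d')=\limsup_{n\to\infty}\frac{\log_q A_S(q,n,\lceil nd'\rceil)}{\log_q|E(q,n)|},\qquad a_S(r',d')=\limsup_{n\to\infty,\ n\in N}\frac{\log_q A_C(q,n,r_n,\lceil nd'/2\rceil)}{\log_q|E(q,n)|},$$ where $N$ is any infinite set of positive integers and $r_n$ $(n\in N)$ are any integers with $0\le r_n\le n$ and $r_n/n\to r'$ as $n\to\infty$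 in $N$. (For example, $N$ is the set of all $n$ for which $nr'$ is an integer and $r_n=nr'$, when $r'$ is rational; or $N$ is the set of all positive integers and $r_n=\lfloor nr'\rfloor$, for any real $r'$.) Then, for all $0\le d'\le 1$: 1. $a_S(d')=1-d'$. 2. For every choice of $N$ and $(r_n)$ as above, - $a_S(r',d')=0$ if $0\le r'\le \frac{d'}2$ or $1-\frac{d'}2\le r'\le 1$; - $a_S(r',d')=2(1-r')(2r'-d')$ if $\frac{d'}2\le r'\le\frac12$; - $a_S(r',d')=2r'(2-2r'-d')$ if $\frac12\le r'\le 1-\frac{d'}2$. -/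

import Mathlib

open Filter Topology

namespace SubspaceCode

variable {F : Type*} [Field F] {n : ℕ}

/-- The subspace distance `dim (U + V) - dim (U ∩ V)`; the subtraction never truncates. -/
noncomputable def subspaceDist (U V : Submodule F (Fin n → F)) : ℕ :=
  Module.finrank F ↥(U ⊔ V) - Module.finrank F ↥(U ⊓ V)

/-- The injection distance `max (dim U) (dim V) - dim (U ∩ V)`; the subtraction never truncates. -/
noncomputable def injectionDist (U V : Submodule F (Fin n → F)) : ℕ :=
  max (Module.finrank F U) (Module.finrank F V) - Module.finrank F ↥(U ⊓ V)

/-- `C` is a subspace code (a nonempty set of subspaces of `F ^ n`) in which distinct codewords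
have subspace distance at least `d`. -/
def IsCode (d : ℕ) (C : Set (Submodule F (Fin n → F))) : Prop :=
  C.Nonempty ∧ C.Pairwise fun U V => d ≤ subspaceDist U V

/-- `C` is a constant-dimension code (a nonempty set of `r`-dimensional subspaces of `F ^ n`) in
which distinct codewords have injection distance at least `d`. -/
def IsCDC (r d : ℕ) (C : Set (Submodule F (Fin n → F))) : Prop :=
  C.Nonempty ∧ (∀ U ∈ C, Module.finrank F U = r) ∧ C.Pairwise fun U V => d ≤ injectionDist U V

variable (F)

/-- The number `|E(q, n)|` of all subspaces of `F ^ n`. -/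
noncomputable def numSubspaces (n : ℕ) : ℕ :=
  Nat.card (Submodule F (Fin n → F))

/-- `A_S(q, n, d)`: the maximum cardinality of a subspace code in `F ^ n` with minimum subspace
distance (at least) `d`. For finite `F` the supremum is a maximum. -/
noncomputable def maxCode (n d : ℕ) : ℕ :=
  sSup {k | ∃ C : Set (Submodule F (Fin n → F)), IsCode d C ∧ C.ncard = k}

/-- `A_C(q, n, r, d)`: the maximum cardinality of a constant-dimension code of dimension `r` in
`F ^ n` with minimum injection distance (at least) `d`. For finite `F` and `r ≤ n` the supremum
is a maximum. -/
noncomputable def maxCDC (n r d : ℕ) : ℕ :=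
  sSup {k | ∃ C : Set (Submodule F (Fin n → F)), IsCDC r d C ∧ C.ncard = k}

/-- The rate `log_q M / log_q |E(q, n)|` of a code with `M` codewords in `E(q, n)`. -/
noncomputable def rate (n M : ℕ) : ℝ :=
  Real.logb (Nat.card F) M / Real.logb (Nat.card F) (numSubspaces F n)

/-- The asymptotic rate of subspace codes of relative minimum subspace distance `d'`. The upper
limit is taken in the extended reals, so that it is defined without any boundedness proviso. -/
noncomputable def asympRate (d' : ℝ) : EReal :=
  limsup (fun n : ℕ => (rate F n (maxCode F n ⌈(n : ℝ) * d'⌉₊) : EReal)) atTop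

/-- The asymptotic rate of constant-dimension codes of relative minimum subspace distance `d'`,
with the length `n` tending to infinity in the set `N` and with dimension `r n` in length `n`. -/
noncomputable def asympRateCDC (N : Set ℕ) (r : ℕ → ℕ) (d' : ℝ) : EReal :=
  limsup (fun n : ℕ => (rate F n (maxCDC F n (r n) ⌈(n : ℝ) * (d' / 2)⌉₊) : EReal)) (atTop ⊓ 𝓟 N)

end SubspaceCode

/-!
Up to a factor `q ^ O(n)`, a largest constant-dimension code has `q ^ e` codewords, where
`e = max r (n - r) * max 0 (min r (n - r) - d)`. Passing to orthogonal complements one may assume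
`2 * r ≤ n`. Then distinct codewords share no linearly independent tuple of length `r - d + 1`, and
counting such tuples gives the upper bound; the graphs of the linear maps `x ↦ ∑ i, a i * x ^ q ^ i`
on an extension field (lifted Gabidulin codes) give the lower bound. A subspace code splits into
`n + 1` constant-dimension codes, and the exponent is largest at dimension `n / 2`, which determines
the size of subspace codes; distance `0` yields `log_q |E(q, n)| ∼ n ^ 2 / 4`. As the exponent is
homogeneous of degree two and continuous in `(n, r, d)`, dividing by `n ^ 2` gives the limits.
-/

namespace SubspaceCode

open Module Polynomial

section Codes

variable {F : Type*} [Field F] {n r d e : ℕ} {C : Set (Submodule F (Fin n → F))}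

theorem IsCode.ncard_le_maxCode [Finite F] (hC : IsCode d C) : C.ncard ≤ maxCode F n d :=
  le_csSup ⟨numSubspaces F n, by rintro _ ⟨D, -, rfl⟩; exact Set.ncard_le_card D⟩ ⟨C, hC, rfl⟩

theorem IsCDC.ncard_le_maxCDC [Finite F] (hC : IsCDC r d C) : C.ncard ≤ maxCDC F n r d :=
  le_csSup ⟨numSubspaces F n, by rintro _ ⟨D, -, rfl⟩; exact Set.ncard_le_card D⟩ ⟨C, hC, rfl⟩

theorem maxCode_le {B : ℕ}
    (h : ∀ C : Set (Submodule F (Fin n → F)), IsCode d C → C.ncard ≤ B) : maxCode F n d ≤ B :=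
  csSup_le' (by rintro _ ⟨C, hC, rfl⟩; exact h C hC)

theorem maxCDC_le {B : ℕ}
    (h : ∀ C : Set (Submodule F (Fin n → F)), IsCDC r d C → C.ncard ≤ B) : maxCDC F n r d ≤ B :=
  csSup_le' (by rintro _ ⟨C, hC, rfl⟩; exact h C hC)

theorem maxCode_zero [Finite F] : maxCode F n 0 = numSubspaces F n := by
  refine le_antisymm (maxCode_le fun C _ => Set.ncard_le_card C) ?_
  have huniv : IsCode 0 (Set.univ : Set (Submodule F (Fin n → F))) :=
    ⟨Set.univ_nonempty, fun _ _ _ _ _ => Nat.zero_le _⟩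
  exact (Set.ncard_univ _).symm.trans_le huniv.ncard_le_maxCode

theorem subspaceDist_eq_two_mul_injectionDist {U V : Submodule F (Fin n → F)}
    (h : finrank F U = finrank F V) : subspaceDist U V = 2 * injectionDist U V := by
  have := Submodule.finrank_sup_add_finrank_inf_eq U V
  have := Submodule.finrank_mono (inf_le_left : U ⊓ V ≤ U)
  unfold subspaceDist injectionDist
  omega

theorem IsCDC.isCode (hC : IsCDC r e C) (hde : d ≤ 2 * e) : IsCode d C := by
  obtain ⟨hne, hdim, hdist⟩ := hC
  refine ⟨hne, fun U hU V hV hUV => ?_⟩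
  have : e ≤ injectionDist U V := hdist hU hV hUV
  change d ≤ subspaceDist U V
  rw [subspaceDist_eq_two_mul_injectionDist ((hdim U hU).trans (hdim V hV).symm)]
  omega

theorem IsCode.isCDC_sep (hC : IsCode d C) (hde : 2 * e ≤ d + 1)
    (hne : {U ∈ C | finrank F U = r}.Nonempty) : IsCDC r e {U ∈ C | finrank F U = r} := by
  refine ⟨hne, fun U hU => hU.2, fun U hU V hV hUV => ?_⟩
  have hdist : d ≤ subspaceDist U V := hC.2 hU.1 hV.1 hUV
  rw [subspaceDist_eq_two_mul_injectionDist (hU.2.trans hV.2.symm)] at hdist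
  omega

theorem maxCDC_le_maxCode [Finite F] (hde : d ≤ 2 * e) : maxCDC F n r e ≤ maxCode F n d :=
  maxCDC_le fun _ hC => (hC.isCode hde).ncard_le_maxCode

theorem maxCode_le_sum_maxCDC [Finite F] (hde : 2 * e ≤ d + 1) :
    maxCode F n d ≤ ∑ r ∈ Finset.range (n + 1), maxCDC F n r e := by
  refine maxCode_le fun C hC => ?_
  have hlayers : C ⊆ ⋃ r ∈ Finset.range (n + 1), {U ∈ C | finrank F U = r} := fun U hU => by
    have : finrank F U ≤ n := by simpa using U.finrank_le
    simpa [hU] using Nat.lt_succ_of_le this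
  refine (Set.ncard_le_ncard hlayers).trans <| (Finset.set_ncard_biUnion_le _ _).trans <|
    Finset.sum_le_sum fun r _ => ?_
  rcases Set.eq_empty_or_nonempty {U ∈ C | finrank F U = r} with hempty | hne
  · simp [hempty]
  · exact (hC.isCDC_sep hde hne).ncard_le_maxCDC

end Codes

section Duality

variable {F : Type*} [Field F] {n r d : ℕ}

/-- The order-reversing bijection taking a subspace of `F ^ n` to its orthogonal complement with
respect to the dot product, encoded as its annihilator read in the dual of the standard basis. -/
noncomputable def orthogonalIso (F : Type*) [Field F] (n : ℕ) :
    Submodule F (Fin n → F) ≃o (Submodule F (Fin n → F))ᵒᵈ :=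
  Subspace.orderIsoFiniteDimensional.trans
    (Submodule.orderIsoMapComap (Pi.basisFun F (Fin n)).toDualEquiv.symm).dual

/-- The orthogonal complement of a subspace of `F ^ n`; over a finite field it may meet the
subspace. It serves to exchange the dimensions `r` and `n - r`. -/
noncomputable def orthogonal (U : Submodule F (Fin n → F)) : Submodule F (Fin n → F) :=
  OrderDual.ofDual (orthogonalIso F n U)

theorem orthogonal_injective :
    Function.Injective (orthogonal : Submodule F (Fin n → F) → Submodule F (Fin n → F)) :=
  (orthogonalIso F n).injective

theorem orthogonal_sup (U V : Submodule F (Fin n → F)) :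
    orthogonal (U ⊔ V) = orthogonal U ⊓ orthogonal V :=
  (orthogonalIso F n).map_sup U V

theorem finrank_add_finrank_orthogonal (U : Submodule F (Fin n → F)) :
    finrank F U + finrank F (orthogonal U) = n := by
  have hdual : finrank F (orthogonal U) = finrank F U.dualAnnihilator :=
    LinearEquiv.finrank_map_eq (Pi.basisFun F (Fin n)).toDualEquiv.symm _
  rw [hdual, Subspace.finrank_add_finrank_dualAnnihilator_eq, finrank_fin_fun]

theorem injectionDist_orthogonal (U V : Submodule F (Fin n → F)) :
    injectionDist (orthogonal U) (orthogonal V) = injectionDist U V := by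
  have := Submodule.finrank_sup_add_finrank_inf_eq U V
  have := finrank_add_finrank_orthogonal U
  have := finrank_add_finrank_orthogonal V
  have := finrank_add_finrank_orthogonal (U ⊔ V)
  unfold injectionDist
  rw [← orthogonal_sup]
  omega

theorem IsCDC.image_orthogonal {C : Set (Submodule F (Fin n → F))} (hC : IsCDC r d C) :
    IsCDC (n - r) d (orthogonal '' C) := by
  obtain ⟨hne, hdim, hdist⟩ := hC
  refine ⟨hne.image _, ?_, ?_⟩
  · rintro _ ⟨U, hU, rfl⟩
    have := finrank_add_finrank_orthogonal U
    have := hdim U hU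
    omega
  · rw [orthogonal_injective.injOn.pairwise_image]
    exact fun U hU V hV hUV => (hdist hU hV hUV).trans_eq (injectionDist_orthogonal U V).symm

theorem maxCDC_le_maxCDC_sub [Finite F] : maxCDC F n r d ≤ maxCDC F n (n - r) d :=
  maxCDC_le fun C hC => by
    rw [← Set.ncard_image_of_injective C orthogonal_injective]
    exact hC.image_orthogonal.ncard_le_maxCDC

theorem maxCDC_sub [Finite F] (hr : r ≤ n) : maxCDC F n (n - r) d = maxCDC F n r d := by
  refine le_antisymm ?_ maxCDC_le_maxCDC_sub
  simpa only [Nat.sub_sub_self hr] using maxCDC_le_maxCDC_sub (F := F) (n := n) (r := n - r)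

end Duality

section Packing

variable {F V : Type*} [Field F] [AddCommGroup V] [Module F V] {r t : ℕ}

theorem pow_le_card_linearIndependent [Finite F] [Finite V] (ht : t ≤ finrank F V) :
    Nat.card F ^ ((finrank F V - 1) * t) ≤
      Nat.card {s : Fin t → V // LinearIndependent F s} := by
  have := Fintype.ofFinite F
  have hq : 2 ≤ Nat.card F := Finite.one_lt_card
  rw [card_linearIndependent ht, ← Nat.card_eq_fintype_card, pow_mul]
  refine (Fin.prod_const t _).symm.trans_le (Finset.prod_le_prod' fun i _ => ?_)
  set m := finrank F V
  have hm0 : 1 ≤ m := by have := i.isLt; omega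
  have hi : Nat.card F ^ (i : ℕ) ≤ Nat.card F ^ (m - 1) :=
    Nat.pow_le_pow_right (by omega) (by omega)
  have hm : 2 * Nat.card F ^ (m - 1) ≤ Nat.card F ^ m := by
    rw [← Nat.sub_add_cancel hm0, pow_succ', Nat.add_sub_cancel]
    exact Nat.mul_le_mul_right _ hq
  omega

theorem le_finrank_of_linearIndependent_of_mem [FiniteDimensional F V] {s : Fin t → V}
    (hs : LinearIndependent F s) {U : Submodule F V} (hU : ∀ i, s i ∈ U) : t ≤ finrank F U := by
  have hspan : Submodule.span F (Set.range s) ≤ U :=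
    Submodule.span_le.2 (Set.range_subset_iff.2 hU)
  simpa [finrank_span_eq_card hs] using Submodule.finrank_mono hspan

theorem ncard_mul_pow_le_of_finrank_inf_lt [Finite F] [Finite V] {C : Set (Submodule F V)}
    (hdim : ∀ U ∈ C, finrank F U = r) (ht : t ≤ r)
    (hinf : C.Pairwise fun U W => finrank F ↥(U ⊓ W) < t) :
    C.ncard * Nat.card F ^ ((r - 1) * t) ≤ Nat.card F ^ (finrank F V * t) := by
  have := Fintype.ofFinite C
  let tuple : (Σ U : C, {s : Fin t → U.1 // LinearIndependent F s}) → (Fin t → V) :=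
    fun x i => x.2.1 i
  have htuple : Function.Injective tuple := by
    rintro ⟨⟨U, hU⟩, s, hs⟩ ⟨⟨W, hW⟩, s', hs'⟩ hss'
    have hval (i : Fin t) : (s i : V) = s' i := congrFun hss' i
    obtain rfl : U = W := hinf.eq hU hW <| not_lt.2 <|
      le_finrank_of_linearIndependent_of_mem (hs.map' U.subtype (Submodule.ker_subtype U))
        fun i => ⟨(s i).2, by simp [hval i]⟩
    obtain rfl : s = s' := funext fun i => Subtype.ext (hval i)
    rfl
  calc C.ncard * Nat.card F ^ ((r - 1) * t)
      ≤ ∑ U : C, Nat.card {s : Fin t → U.1 // LinearIndependent F s} := by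
        rw [← Nat.card_coe_set_eq, Nat.card_eq_fintype_card, ← smul_eq_mul]
        refine Finset.card_nsmul_le_sum _ _ _ fun U _ => ?_
        rw [← hdim U U.2]
        exact pow_le_card_linearIndependent (by rwa [hdim U U.2])
    _ ≤ Nat.card (Fin t → V) := by
        rw [← Nat.card_sigma]
        exact Nat.card_le_card_of_injective tuple htuple
    _ = Nat.card F ^ (finrank F V * t) := by
        rw [Nat.card_fun, Nat.card_fin, natCard_eq_pow_finrank (K := F), pow_mul]

theorem ncard_le_pow_of_finrank_inf_lt [Finite F] [Finite V] {C : Set (Submodule F V)}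
    (hdim : ∀ U ∈ C, finrank F U = r) (ht : t ≤ r)
    (hinf : C.Pairwise fun U W => finrank F ↥(U ⊓ W) < t) :
    C.ncard ≤ Nat.card F ^ ((finrank F V - r + 1) * t) := by
  rcases C.eq_empty_or_nonempty with rfl | ⟨U, hU⟩
  · simp
  have hr : r ≤ finrank F V := hdim U hU ▸ U.finrank_le
  have hexp : finrank F V * t = (finrank F V - r + 1) * t + (r - 1) * t := by
    rcases Nat.eq_zero_or_pos t with rfl | ht0
    · simp
    · rw [← add_mul]
      congr 1
      omega
  have hcount := ncard_mul_pow_le_of_finrank_inf_lt hdim ht hinf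
  rw [hexp, pow_add] at hcount
  exact Nat.le_of_mul_le_mul_right hcount (pow_pos Nat.card_pos _)

end Packing

section UpperBound

variable {F : Type*} [Field F] {n r d : ℕ}

-- The truncation `d - 1` covers `d = 0`: distinct codewords are at injection distance at least `1`.
theorem IsCDC.finrank_inf_lt {C : Set (Submodule F (Fin n → F))} (hC : IsCDC r d C) :
    C.Pairwise fun U V => finrank F ↥(U ⊓ V) < r - (d - 1) := by
  obtain ⟨-, hdim, hdist⟩ := hC
  intro U hU V hV hUV
  have hd : d ≤ injectionDist U V := hdist hU hV hUV
  have hlt : finrank F ↥(U ⊓ V) < r := by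
    by_contra! hle
    exact hUV <| (Submodule.eq_of_le_of_finrank_le inf_le_left (hdim U hU ▸ hle)).symm.trans
      (Submodule.eq_of_le_of_finrank_le inf_le_right (hdim V hV ▸ hle))
  rw [injectionDist, hdim U hU, hdim V hV, max_self] at hd
  omega

theorem maxCDC_le_pow [Finite F] :
    maxCDC F n r d ≤ Nat.card F ^ ((n - r + 1) * (r - (d - 1))) :=
  maxCDC_le fun C hC => by
    simpa using ncard_le_pow_of_finrank_inf_lt hC.2.1 (Nat.sub_le r (d - 1)) hC.finrank_inf_lt

end UpperBound

section Gabidulin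

variable {k : ℕ}

/-- The linearized polynomial `∑ i, a i * X ^ q ^ i` of `q`-degree less than `k`. -/
noncomputable def linearizedPolynomial {R : Type*} [Semiring R] (q : ℕ) (a : Fin k → R) : R[X] :=
  ∑ i : Fin k, monomial (q ^ (i : ℕ)) (a i)

theorem linearizedPolynomial_ne_zero {R : Type*} [Semiring R] {q : ℕ} (hq : 1 < q)
    {a : Fin k → R} (ha : a ≠ 0) : linearizedPolynomial q a ≠ 0 := by
  obtain ⟨j, hj⟩ := Function.ne_iff.1 ha
  have hcoeff : (linearizedPolynomial q a).coeff (q ^ (j : ℕ)) = a j := by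
    simp [linearizedPolynomial, coeff_monomial, (Nat.pow_right_injective hq).eq_iff,
      Fin.val_inj]
  exact fun h => hj (by simpa [h] using hcoeff.symm)

theorem natDegree_linearizedPolynomial_le {R : Type*} [Semiring R] {q : ℕ} (hq : 0 < q)
    (a : Fin k → R) : (linearizedPolynomial q a).natDegree ≤ q ^ (k - 1) :=
  natDegree_sum_le_of_forall_le _ _ fun i _ =>
    (natDegree_monomial_le _).trans (Nat.pow_le_pow_right hq (by omega))

/-- The map sending the coefficients `a` to the `F`-linear map `x ↦ ∑ i, a i * x ^ q ^ i`, where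
`q = |F|`. Its values are the codewords of the Gabidulin code. -/
noncomputable def linearizedMap (F L : Type*) [Field F] [Finite F] [CommRing L] [Algebra F L]
    (k : ℕ) : (Fin k → L) →ₗ[L] (L →ₗ[F] L) :=
  letI := Fintype.ofFinite F
  Fintype.linearCombination L fun i : Fin k =>
    (FiniteField.frobeniusAlgHom F L ^ (i : ℕ)).toLinearMap

variable {F : Type*} [Field F] [Finite F]

theorem linearizedMap_apply {L : Type*} [CommRing L] [Algebra F L] (a : Fin k → L) (x : L) :
    linearizedMap F L k a x = (linearizedPolynomial (Nat.card F) a).eval x := by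
  simp [linearizedMap, linearizedPolynomial, Fintype.linearCombination_apply, eval_finsetSum,
    AlgHom.coe_pow, FiniteField.coe_frobeniusAlgHom, pow_iterate, Fintype.card_eq_nat_card,
    -Nat.card_eq_fintype_card]

theorem finrank_ker_linearizedMap_lt {L : Type*} [CommRing L] [IsDomain L] [Algebra F L]
    {a : Fin k → L} (ha : a ≠ 0) : finrank F (linearizedMap F L k a).ker < k := by
  have hq : 1 < Nat.card F := Finite.one_lt_card
  set p := linearizedPolynomial (Nat.card F) a
  have hker : ((linearizedMap F L k a).ker : Set L) = p.rootSet L := by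
    ext x
    simp [linearizedMap_apply, mem_rootSet, linearizedPolynomial_ne_zero hq ha, p]
  have : Finite (linearizedMap F L k a).ker := (hker ▸ p.rootSet_finite L : Set.Finite _)
  have hcard : Nat.card F ^ finrank F (linearizedMap F L k a).ker ≤ Nat.card F ^ (k - 1) := by
    rw [← natCard_eq_pow_finrank, ← SetLike.coe_sort_coe, hker, Nat.card_coe_set_eq]
    exact (p.ncard_rootSet_le L).trans (natDegree_linearizedPolynomial_le hq.le a)
  have hle := (Nat.pow_le_pow_iff_right hq).1 hcard
  obtain ⟨j, -⟩ := Function.ne_iff.1 ha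
  have := j.isLt
  omega

theorem finrank_ker_comp_le_of_injective {K U V W : Type*} [Field K] [AddCommGroup U] [Module K U]
    [AddCommGroup V] [Module K V] [FiniteDimensional K V] [AddCommGroup W] [Module K W]
    (g : V →ₗ[K] W) {f : U →ₗ[K] V} (hf : Function.Injective f) :
    finrank K (g ∘ₗ f).ker ≤ finrank K g.ker :=
  LinearMap.finrank_le_finrank_of_injective (f := f.restrict (p := (g ∘ₗ f).ker) fun _ hx => hx)
    fun _ _ h => Subtype.ext (hf (congrArg Subtype.val h))

theorem exists_algebra_finrank_eq (F : Type*) [Field F] [Finite F] {m : ℕ} (hm : m ≠ 0) :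
    ∃ (L : Type) (_ : Field L) (_ : Algebra F L), FiniteDimensional F L ∧ finrank F L = m := by
  obtain ⟨p, _⟩ := CharP.exists F
  have : Fact p.Prime := ⟨CharP.char_is_prime F p⟩
  have : NeZero m := ⟨hm⟩
  exact ⟨FiniteField.Extension F p m, inferInstance, inferInstance, inferInstance,
    FiniteField.finrank_extension F p m⟩

variable {V W : Type*} [AddCommGroup V] [Module F V] [FiniteDimensional F V]
  [AddCommGroup W] [Module F W] [FiniteDimensional F W]

theorem exists_rankMetricCode (hVW : finrank F V ≤ finrank F W) (hk : k ≤ finrank F V) :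
    ∃ S : Set (V →ₗ[F] W), S.ncard = Nat.card F ^ (finrank F W * k) ∧
      S.Pairwise fun f g => finrank F V < k + finrank F (f - g).range := by
  rcases Nat.eq_zero_or_pos k with rfl | hk0
  · exact ⟨{0}, by simp⟩
  obtain ⟨L, _, _, _, hL⟩ := exists_algebra_finrank_eq F (by omega : finrank F W ≠ 0)
  obtain ⟨ι, hι⟩ := finrank_le_iff_exists_linearMap.1 (hVW.trans_eq hL.symm)
  let e : L ≃ₗ[F] W := LinearEquiv.ofFinrankEq L W hL
  let code (a : Fin k → L) : V →ₗ[F] W := (e.toLinearMap ∘ₗ linearizedMap F L k a) ∘ₗ ι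
  have hrank (a b : Fin k → L) (hab : a ≠ b) :
      finrank F V < k + finrank F (code a - code b).range := by
    have hsub : code a - code b = code (a - b) := by
      simp only [code, map_sub, LinearMap.comp_sub, LinearMap.sub_comp]
    have hker : finrank F (code (a - b)).ker < k := by
      refine (finrank_ker_comp_le_of_injective _ hι).trans_lt ?_
      rw [LinearEquiv.ker_comp]
      exact finrank_ker_linearizedMap_lt (sub_ne_zero.2 hab)
    have := (code (a - b)).finrank_range_add_finrank_ker
    rw [hsub]
    omega
  have hcode : Function.Injective code := fun a b hab => by
    by_contra hne
    have := hrank a b hne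
    rw [hab, sub_self, LinearMap.range_zero, finrank_bot] at this
    omega
  refine ⟨Set.range code, ?_, ?_⟩
  · rw [← Set.image_univ, Set.ncard_image_of_injective _ hcode, Set.ncard_univ, Nat.card_fun,
      Nat.card_fin, natCard_eq_pow_finrank (K := F), hL, pow_mul]
  · rintro _ ⟨a, rfl⟩ _ ⟨b, rfl⟩ hne
    exact hrank a b fun hab => hne (congrArg code hab)

end Gabidulin

section Lifting

variable {F V W : Type*} [Field F] [AddCommGroup V] [Module F V] [AddCommGroup W] [Module F W]
  {n r d : ℕ}

theorem finrank_graph (f : V →ₗ[F] W) : finrank F f.graph = finrank F V := by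
  rw [LinearMap.graph_eq_range_prod]
  exact LinearMap.finrank_range_of_inj fun _ _ h => congrArg Prod.fst h

theorem graph_injective : Function.Injective (LinearMap.graph : (V →ₗ[F] W) → _) :=
  fun f g h => LinearMap.ext fun x =>
    show (x, f x) ∈ g.graph from h ▸ (rfl : f x = f x)

theorem finrank_graph_inf_graph (f g : V →ₗ[F] W) :
    finrank F ↥(f.graph ⊓ g.graph) = finrank F (f - g).ker := by
  have hmap : f.graph ⊓ g.graph = (f - g).ker.map (LinearMap.id.prod f) := by
    ext ⟨x, y⟩
    constructor
    · rintro ⟨hf : y = f x, hg : y = g x⟩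
      exact ⟨x, sub_eq_zero.2 (hf.symm.trans hg), Prod.ext rfl hf.symm⟩
    · rintro ⟨x, hx : f x - g x = 0, ⟨⟩⟩
      exact ⟨rfl, sub_eq_zero.1 hx⟩
  have hinj : Function.Injective (LinearMap.id.prod f) := fun _ _ h => congrArg Prod.fst h
  rw [hmap]
  exact (Submodule.equivMapOfInjective _ hinj _).finrank_eq.symm

/-- The subspace of `F ^ n` lifted from a linear map: its graph, transported along an
identification of `V × W` with `F ^ n`. Lifting turns rank-metric codes into constant-dimension
codes. -/
def liftedSubspace (e : (V × W) ≃ₗ[F] (Fin n → F)) (f : V →ₗ[F] W) :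
    Submodule F (Fin n → F) :=
  f.graph.map e.toLinearMap

theorem liftedSubspace_injective (e : (V × W) ≃ₗ[F] (Fin n → F)) :
    Function.Injective (liftedSubspace e) :=
  (Submodule.map_injective_of_injective e.injective).comp graph_injective

theorem finrank_liftedSubspace (e : (V × W) ≃ₗ[F] (Fin n → F)) (f : V →ₗ[F] W) :
    finrank F (liftedSubspace e f) = finrank F V := by
  rw [liftedSubspace, LinearEquiv.finrank_map_eq, finrank_graph]

theorem injectionDist_liftedSubspace [FiniteDimensional F V] (e : (V × W) ≃ₗ[F] (Fin n → F))
    (f g : V →ₗ[F] W) :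
    injectionDist (liftedSubspace e f) (liftedSubspace e g) = finrank F (f - g).range := by
  have hinf : finrank F ↥(liftedSubspace e f ⊓ liftedSubspace e g) = finrank F (f - g).ker := by
    rw [liftedSubspace, liftedSubspace, ← Submodule.map_inf _ e.injective,
      LinearEquiv.finrank_map_eq, finrank_graph_inf_graph]
  rw [injectionDist, finrank_liftedSubspace, finrank_liftedSubspace, max_self, hinf,
    ← (f - g).finrank_range_add_finrank_ker, Nat.add_sub_cancel]

theorem ncard_le_maxCDC_of_rankMetricCode [Finite F] [FiniteDimensional F V]
    [FiniteDimensional F W] (hn : finrank F V + finrank F W = n) {S : Set (V →ₗ[F] W)}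
    (hne : S.Nonempty) (hS : S.Pairwise fun f g => d ≤ finrank F (f - g).range) :
    S.ncard ≤ maxCDC F n (finrank F V) d := by
  let e : (V × W) ≃ₗ[F] (Fin n → F) := LinearEquiv.ofFinrankEq _ _ (by simpa using hn)
  have hcode : IsCDC (finrank F V) d (liftedSubspace e '' S) := by
    refine ⟨hne.image _, ?_, ?_⟩
    · rintro _ ⟨f, -, rfl⟩
      exact finrank_liftedSubspace e f
    · rw [(liftedSubspace_injective e).injOn.pairwise_image]
      exact fun f hf g hg hfg => (hS hf hg hfg).trans_eq (injectionDist_liftedSubspace e f g).symm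
  rw [← Set.ncard_image_of_injective S (liftedSubspace_injective e)]
  exact hcode.ncard_le_maxCDC

theorem pow_le_maxCDC [Finite F] (hr : 2 * r ≤ n) :
    Nat.card F ^ ((n - r) * (r - d)) ≤ maxCDC F n r d := by
  have hV : finrank F (Fin r → F) = r := finrank_fin_fun F
  have hW : finrank F (Fin (n - r) → F) = n - r := finrank_fin_fun F
  obtain ⟨S, hcard, hrank⟩ := exists_rankMetricCode (F := F) (V := Fin r → F)
    (W := Fin (n - r) → F) (k := r - d) (by omega) (by omega)
  rw [hW] at hcard
  have hne : S.Nonempty := Set.nonempty_of_ncard_ne_zero (hcard ▸ (pow_pos Nat.card_pos _).ne')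
  have hS : S.Pairwise fun f g => d ≤ finrank F (f - g).range := fun f hf g hg hfg => by
    have := hrank hf hg hfg
    have := (f - g).finrank_range_le
    omega
  simpa only [← hcard, hV] using
    ncard_le_maxCDC_of_rankMetricCode (by omega : _ + _ = n) hne hS

end Lifting

section Exponent

variable {n r d : ℝ}

/-- The exponent `e` for which `q ^ e` is the order of magnitude of `A_C(q, n, r, d)`, as a function
of real arguments: `(n - r) * (r - d)⁺` for `2 * r ≤ n`, extended symmetrically under
`r ↦ n - r`. -/
def cdcExponent (n r d : ℝ) : ℝ :=
  max r (n - r) * max 0 (min r (n - r) - d)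

theorem cdcExponent_sub : cdcExponent n (n - r) d = cdcExponent n r d := by
  simp only [cdcExponent, sub_sub_cancel, max_comm (n - r), min_comm (n - r)]

theorem cdcExponent_of_two_mul_le (hr : 2 * r ≤ n) :
    cdcExponent n r d = (n - r) * max 0 (r - d) := by
  rw [cdcExponent, max_eq_right (by linarith), min_eq_left (by linarith)]

theorem cdcExponent_of_le (hd : d ≤ r) (hr : 2 * r ≤ n) :
    cdcExponent n r d = (n - r) * (r - d) := by
  rw [cdcExponent_of_two_mul_le hr, max_eq_right (sub_nonneg.2 hd)]

theorem cdcExponent_eq_zero (h : min r (n - r) ≤ d) : cdcExponent n r d = 0 := by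
  rw [cdcExponent, max_eq_left (sub_nonpos.2 h), mul_zero]

theorem cdcExponent_natCast {n r d : ℕ} (hr : 2 * r ≤ n) :
    cdcExponent n r d = ((n - r) * (r - d) : ℕ) := by
  have hrn : r ≤ n := by omega
  rw [cdcExponent_of_two_mul_le (by exact_mod_cast hr), Nat.cast_mul, Nat.cast_sub hrn]
  rcases le_total d r with hd | hd
  · rw [Nat.cast_sub hd, max_eq_right (sub_nonneg.2 (by exact_mod_cast hd))]
  · rw [Nat.sub_eq_zero_of_le hd, max_eq_left (sub_nonpos.2 (by exact_mod_cast hd)), Nat.cast_zero]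

theorem cdcExponent_antitone (hn : 0 ≤ n) : Antitone (cdcExponent n r) := fun d d' hdd' => by
  have : 0 ≤ max r (n - r) := by linarith [le_max_left r (n - r), le_max_right r (n - r)]
  unfold cdcExponent
  gcongr

theorem cdcExponent_le_half (hn : 0 ≤ n) (hd : 0 ≤ d) :
    cdcExponent n r d ≤ cdcExponent n (n / 2) d := by
  wlog hr : 2 * r ≤ n generalizing r
  · rw [← cdcExponent_sub]
    exact this (by linarith)
  rw [cdcExponent_of_two_mul_le hr, cdcExponent_of_two_mul_le (by linarith), sub_half]
  rcases le_total r d with hrd | hrd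
  · rw [max_eq_left (sub_nonpos.2 hrd), mul_zero]
    positivity
  · rw [max_eq_right (sub_nonneg.2 hrd), max_eq_right (by linarith)]
    nlinarith [mul_nonneg hd (by linarith : 0 ≤ n / 2 - r), sq_nonneg (n / 2 - r)]

theorem cdcExponent_div {c : ℝ} (hc : 0 ≤ c) :
    cdcExponent (n / c) (r / c) (d / c) = cdcExponent n r d / c ^ 2 := by
  have hmax (x : ℝ) : max 0 (x / c) = max 0 x / c := by
    rw [← max_div_div_right hc, zero_div]
  simp only [cdcExponent, ← sub_div, max_div_div_right hc, min_div_div_right hc, hmax, sq,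
    mul_div_mul_comm]

theorem continuous_cdcExponent : Continuous fun p : ℝ × ℝ × ℝ => cdcExponent p.1 p.2.1 p.2.2 := by
  unfold cdcExponent
  fun_prop

theorem tendsto_cdcExponent_div_sq {ι : Type*} {l : Filter ι} {x y z s : ι → ℝ}
    (hs : ∀ i, 0 ≤ s i) (hx : Tendsto (fun i => x i / s i) l (𝓝 n))
    (hy : Tendsto (fun i => y i / s i) l (𝓝 r)) (hz : Tendsto (fun i => z i / s i) l (𝓝 d)) :
    Tendsto (fun i => cdcExponent (x i) (y i) (z i) / s i ^ 2) l (𝓝 (cdcExponent n r d)) := by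
  simpa only [Function.comp_def, cdcExponent_div (hs _)] using
    (continuous_cdcExponent.tendsto (n, r, d)).comp (hx.prodMk_nhds (hy.prodMk_nhds hz))

end Exponent

section SizeBounds

variable {F : Type*} [Field F] [Finite F] {n r d : ℕ}

theorem one_lt_natCard_real (F : Type*) [Field F] [Finite F] : (1 : ℝ) < Nat.card F :=
  Nat.one_lt_cast.2 Finite.one_lt_card

theorem rpow_cdcExponent_le_maxCDC (hr : r ≤ n) :
    (Nat.card F : ℝ) ^ cdcExponent n r d ≤ maxCDC F n r d := by
  wlog h : 2 * r ≤ n generalizing r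
  · rw [← maxCDC_sub hr, ← cdcExponent_sub, ← Nat.cast_sub hr]
    exact this (Nat.sub_le n r) (by omega)
  rw [cdcExponent_natCast h, Real.rpow_natCast]
  exact_mod_cast pow_le_maxCDC h

theorem maxCDC_le_rpow_cdcExponent (hr : r ≤ n) :
    (maxCDC F n r d : ℝ) ≤ (Nat.card F : ℝ) ^ cdcExponent (n + 2) (r + 1) d := by
  wlog h : 2 * r ≤ n generalizing r
  · have hsymm : (n : ℝ) + 2 - (r + 1) = (n - r : ℕ) + 1 := by
      rw [Nat.cast_sub hr]
      ring
    rw [← maxCDC_sub hr, ← cdcExponent_sub, hsymm]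
    exact this (Nat.sub_le n r) (by omega)
  have hexp : cdcExponent (n + 2) (r + 1) d = ((n - r + 1) * (r + 1 - d) : ℕ) := by
    rw [(by omega : n - r + 1 = n + 2 - (r + 1)), ← cdcExponent_natCast (by omega)]
    push_cast
    rfl
  rw [hexp, Real.rpow_natCast]
  exact_mod_cast maxCDC_le_pow.trans
    (Nat.pow_le_pow_right Nat.card_pos (Nat.mul_le_mul_left _ (by omega)))

theorem rpow_cdcExponent_le_maxCode (hr : r ≤ n) :
    (Nat.card F : ℝ) ^ cdcExponent n r ((d + 1) / 2) ≤ maxCode F n d := by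
  have he : (((d + 1) / 2 : ℕ) : ℝ) ≤ (d + 1) / 2 := by exact_mod_cast Nat.cast_div_le
  calc (Nat.card F : ℝ) ^ cdcExponent n r ((d + 1) / 2)
      ≤ (Nat.card F : ℝ) ^ cdcExponent n r ((d + 1) / 2 : ℕ) :=
        Real.rpow_le_rpow_of_exponent_le (one_lt_natCard_real F).le
          (cdcExponent_antitone n.cast_nonneg he)
    _ ≤ maxCDC F n r ((d + 1) / 2) := rpow_cdcExponent_le_maxCDC hr
    _ ≤ maxCode F n d := by exact_mod_cast maxCDC_le_maxCode (by omega)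

theorem maxCode_le_rpow_cdcExponent :
    (maxCode F n d : ℝ) ≤
      (Nat.card F : ℝ) ^ (n + cdcExponent (n + 2) ((n + 2) / 2) (d / 2)) := by
  set q := (Nat.card F : ℝ)
  let e := (d + 1) / 2
  have hde : (d : ℝ) / 2 ≤ e := by
    rw [div_le_iff₀ two_pos]
    exact_mod_cast (by omega : d ≤ e * 2)
  have hlayer (r : ℕ) (hr : r ∈ Finset.range (n + 1)) :
      (maxCDC F n r e : ℝ) ≤ q ^ cdcExponent (n + 2) ((n + 2) / 2) (d / 2) :=
    (maxCDC_le_rpow_cdcExponent (Finset.mem_range_succ_iff.1 hr)).trans <|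
      Real.rpow_le_rpow_of_exponent_le (one_lt_natCard_real F).le <|
        (cdcExponent_antitone (by positivity) hde).trans
          (cdcExponent_le_half (by positivity) (by positivity))
  have hn : ((n + 1 : ℕ) : ℝ) ≤ q ^ n :=
    (Nat.cast_le.2 (Nat.lt_pow_self Finite.one_lt_card)).trans_eq (Nat.cast_pow _ _)
  calc (maxCode F n d : ℝ)
      ≤ ∑ r ∈ Finset.range (n + 1), (maxCDC F n r e : ℝ) := by
        exact_mod_cast maxCode_le_sum_maxCDC (by omega)
    _ ≤ (n + 1 : ℕ) * q ^ cdcExponent (n + 2) ((n + 2) / 2) (d / 2) := by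
        simpa using Finset.sum_le_card_nsmul _ _ _ hlayer
    _ ≤ q ^ n * q ^ cdcExponent (n + 2) ((n + 2) / 2) (d / 2) := by gcongr
    _ = q ^ (n + cdcExponent (n + 2) ((n + 2) / 2) (d / 2)) := by
        rw [Real.rpow_add (zero_lt_one.trans (one_lt_natCard_real F)), Real.rpow_natCast]

end SizeBounds

section Limits

theorem tendsto_logb_div_of_rpow_le_of_le_rpow {ι : Type*} {l : Filter ι} {f g M s : ι → ℝ}
    {b c : ℝ} (hb : 1 < b) (hs : ∀ i, 0 ≤ s i) (hf : Tendsto (fun i => f i / s i) l (𝓝 c))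
    (hg : Tendsto (fun i => g i / s i) l (𝓝 c)) (hfM : ∀ᶠ i in l, b ^ f i ≤ M i)
    (hMg : ∀ᶠ i in l, M i ≤ b ^ g i) :
    Tendsto (fun i => Real.logb b (M i) / s i) l (𝓝 c) := by
  have hM : ∀ᶠ i in l, 0 < M i :=
    hfM.mono fun i h => (Real.rpow_pos_of_pos (zero_lt_one.trans hb) _).trans_le h
  refine tendsto_of_tendsto_of_tendsto_of_le_of_le' hf hg ?_ ?_
  · filter_upwards [hfM, hM] with i h hpos
    exact div_le_div_of_nonneg_right ((Real.le_logb_iff_rpow_le hb hpos).2 h) (hs i)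
  · filter_upwards [hMg, hM] with i h hpos
    exact div_le_div_of_nonneg_right ((Real.logb_le_iff_le_rpow hb hpos).2 h) (hs i)

theorem tendsto_add_const_div_natCast {l : Filter ℕ} (hl : l ≤ atTop) {a : ℕ → ℝ} {α : ℝ}
    (ha : Tendsto (fun n => a n / n) l (𝓝 α)) (c : ℝ) :
    Tendsto (fun n => (a n + c) / n) l (𝓝 α) := by
  simpa only [add_div, add_zero] using
    ha.add ((tendsto_const_div_atTop_nhds_zero_nat c).mono_left hl)

theorem tendsto_natCast_div_self : Tendsto (fun n : ℕ => (n : ℝ) / n) atTop (𝓝 1) :=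
  tendsto_const_nhds.congr' <| (eventually_ne_atTop 0).mono fun _ hn =>
    (div_self (Nat.cast_ne_zero.2 hn)).symm

variable {F : Type*} [Field F] [Finite F]

theorem tendsto_logb_maxCDC {l : Filter ℕ} (hl : l ≤ atTop) {r d : ℕ → ℕ} {ρ δ : ℝ}
    (hrn : ∀ᶠ n in l, r n ≤ n) (hr : Tendsto (fun n => (r n : ℝ) / n) l (𝓝 ρ))
    (hd : Tendsto (fun n => (d n : ℝ) / n) l (𝓝 δ)) :
    Tendsto (fun n : ℕ => Real.logb (Nat.card F) (maxCDC F n (r n) (d n)) / (n : ℝ) ^ 2) l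
      (𝓝 (cdcExponent 1 ρ δ)) := by
  have hn := tendsto_natCast_div_self.mono_left hl
  exact tendsto_logb_div_of_rpow_le_of_le_rpow (one_lt_natCard_real F)
    (fun n => sq_nonneg (n : ℝ))
    (tendsto_cdcExponent_div_sq Nat.cast_nonneg hn hr hd)
    (tendsto_cdcExponent_div_sq Nat.cast_nonneg (tendsto_add_const_div_natCast hl hn 2)
      (tendsto_add_const_div_natCast hl hr 1) hd)
    (hrn.mono fun _ => rpow_cdcExponent_le_maxCDC) (hrn.mono fun _ => maxCDC_le_rpow_cdcExponent)

theorem tendsto_logb_maxCode {d : ℕ → ℕ} {δ : ℝ}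
    (hd : Tendsto (fun n => (d n : ℝ) / n) atTop (𝓝 δ)) :
    Tendsto (fun n : ℕ => Real.logb (Nat.card F) (maxCode F n (d n)) / (n : ℝ) ^ 2) atTop
      (𝓝 (cdcExponent 1 (1 / 2) (δ / 2))) := by
  have hn := tendsto_natCast_div_self
  have hhalf : Tendsto (fun n : ℕ => (⌊(1 / 2 : ℝ) * n⌋₊ : ℝ) / n) atTop (𝓝 (1 / 2)) :=
    (tendsto_nat_floor_mul_div_atTop (by norm_num)).comp tendsto_natCast_atTop_atTop
  have hlow := tendsto_cdcExponent_div_sq Nat.cast_nonneg hn hhalf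
    (z := fun n : ℕ => ((d n : ℝ) + 1) / 2) <| by
      simpa only [div_right_comm] using
        (tendsto_add_const_div_natCast le_rfl hd 1).div_const 2
  have hn2 := tendsto_add_const_div_natCast le_rfl hn 2
  have hmain := tendsto_cdcExponent_div_sq Nat.cast_nonneg hn2
    (y := fun n : ℕ => ((n : ℝ) + 2) / 2) (z := fun n : ℕ => (d n : ℝ) / 2)
    (by simpa only [div_right_comm] using hn2.div_const 2)
    (by simpa only [div_right_comm] using hd.div_const 2)
  have hlin : Tendsto (fun n : ℕ => (n : ℝ) / (n : ℝ) ^ 2) atTop (𝓝 0) := by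
    simpa [sq] using tendsto_one_div_atTop_nhds_zero_nat (𝕜 := ℝ)
  have hupp := hlin.add hmain
  simp only [zero_add, ← add_div] at hupp
  refine tendsto_logb_div_of_rpow_le_of_le_rpow (one_lt_natCard_real F)
    (fun n => sq_nonneg (n : ℝ)) hlow hupp (.of_forall fun n => ?_)
    (.of_forall fun n => maxCode_le_rpow_cdcExponent)
  exact rpow_cdcExponent_le_maxCode (Nat.floor_le_of_le (by linarith [n.cast_nonneg (α := ℝ)]))

theorem tendsto_logb_numSubspaces :
    Tendsto (fun n : ℕ => Real.logb (Nat.card F) (numSubspaces F n) / (n : ℝ) ^ 2) atTop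
      (𝓝 (1 / 4)) := by
  have h := tendsto_logb_maxCode (F := F) (d := 0) (δ := 0) (by simp)
  rw [cdcExponent_of_le (by norm_num) (by norm_num)] at h
  norm_num [maxCode_zero] at h ⊢
  exact h

theorem tendsto_rate {l : Filter ℕ} (hl : l ≤ atTop) {M : ℕ → ℕ} {c : ℝ}
    (hM : Tendsto (fun n => Real.logb (Nat.card F) (M n) / (n : ℝ) ^ 2) l (𝓝 c)) :
    Tendsto (fun n => (rate F n (M n) : EReal)) l (𝓝 ((4 * c : ℝ) : EReal)) := by
  refine (continuous_coe_real_ereal.tendsto _).comp ?_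
  have hquot := hM.div ((tendsto_logb_numSubspaces (F := F)).mono_left hl) (by norm_num)
  rw [div_div_eq_mul_div, div_one, mul_comm] at hquot
  refine hquot.congr' (hl ?_)
  filter_upwards [eventually_ne_atTop 0] with n hn
  exact div_div_div_cancel_right₀ (pow_ne_zero 2 (Nat.cast_ne_zero.2 hn)) _ _

theorem tendsto_ceil_natCast_mul_div {a : ℝ} (ha : 0 ≤ a) :
    Tendsto (fun n : ℕ => (⌈(n : ℝ) * a⌉₊ : ℝ) / n) atTop (𝓝 a) := by
  simpa only [Function.comp_def, mul_comm a] using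
    (tendsto_nat_ceil_mul_div_atTop ha).comp tendsto_natCast_atTop_atTop

theorem asympRate_eq {d' : ℝ} (hd : 0 ≤ d') :
    asympRate F d' = ((4 * cdcExponent 1 (1 / 2) (d' / 2) : ℝ) : EReal) :=
  (tendsto_rate le_rfl (tendsto_logb_maxCode (tendsto_ceil_natCast_mul_div hd))).limsup_eq

theorem asympRateCDC_eq {d' ρ : ℝ} (hd : 0 ≤ d') {N : Set ℕ} {r : ℕ → ℕ} (hN : N.Infinite)
    (hrn : ∀ n ∈ N, r n ≤ n) (hr : Tendsto (fun n => (r n : ℝ) / n) (atTop ⊓ 𝓟 N) (𝓝 ρ)) :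
    asympRateCDC F N r d' = ((4 * cdcExponent 1 ρ (d' / 2) : ℝ) : EReal) := by
  have : (atTop ⊓ 𝓟 N).NeBot :=
    frequently_mem_iff_neBot.1 (Nat.frequently_atTop_iff_infinite.2 hN)
  have hrn' : ∀ᶠ n in atTop ⊓ 𝓟 N, r n ≤ n := mem_inf_of_right hrn
  exact (tendsto_rate inf_le_left (tendsto_logb_maxCDC inf_le_left hrn' hr
    ((tendsto_ceil_natCast_mul_div (by positivity)).mono_left inf_le_left))).limsup_eq

end Limits

end SubspaceCode

theorem proposition4 {F : Type*} [Field F] [Finite F] (d' : ℝ) (hd0 : 0 ≤ d') (hd1 : d' ≤ 1) :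
    SubspaceCode.asympRate F d' = ((1 - d' : ℝ) : EReal) ∧
    ∀ r' : ℝ, 0 ≤ r' → r' ≤ 1 →
      ∀ (N : Set ℕ) (r : ℕ → ℕ), N.Infinite → (∀ n ∈ N, r n ≤ n) →
        Tendsto (fun n : ℕ => (r n : ℝ) / n) (atTop ⊓ 𝓟 N) (𝓝 r') →
        ((r' ≤ d' / 2 ∨ 1 - d' / 2 ≤ r') → SubspaceCode.asympRateCDC F N r d' = 0) ∧
        (d' / 2 ≤ r' → r' ≤ 1 / 2 →
          SubspaceCode.asympRateCDC F N r d' = ((2 * (1 - r') * (2 * r' - d') : ℝ) : EReal)) ∧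
        (1 / 2 ≤ r' → r' ≤ 1 - d' / 2 →
          SubspaceCode.asympRateCDC F N r d' = ((2 * r' * (2 - 2 * r' - d') : ℝ) : EReal)) := by
  refine ⟨?_, fun r' _ _ N r hN hrn hr => ?_⟩
  · rw [SubspaceCode.asympRate_eq hd0,
      SubspaceCode.cdcExponent_of_le (by linarith) (by norm_num)]
    congr 1
    ring
  rw [SubspaceCode.asympRateCDC_eq hd0 hN hrn hr]
  refine ⟨fun h => ?_, fun hd hr' => ?_, fun hr' hd => ?_⟩
  · have hmin : min r' (1 - r') ≤ d' / 2 :=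
      min_le_iff.2 (h.imp_right fun h => by linarith)
    rw [SubspaceCode.cdcExponent_eq_zero hmin, mul_zero, EReal.coe_zero]
  · rw [SubspaceCode.cdcExponent_of_le hd (by linarith)]
    congr 1
    ring
  · rw [← SubspaceCode.cdcExponent_sub,
      SubspaceCode.cdcExponent_of_le (by linarith) (by linarith)]
    congr 1
    ring
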